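/- Let $K$ be a field and let $S=K[x_1,\dots,x_n]$. For $\mathfrak c=(c_1,\dots,c_n)\in\mathbb Z_{>0}^n$ and a monomial ideal $I\subset S$, let $I_{\mathfrak c}$ be the ideal generated by the monomials $x_1^{a_1}\cdots x_n^{a_n}\in I$ with $a_i\le c_i$ for all $i$. For a finite simple graph $G$ on $\{x_1,\dots,x_n\}$ without isolated vertices, let $I(G)=(x_ix_j:\{x_i,x_j\}\in E(G))$ be its edge ideal, let $\delta_{\mathfrak c}(I(G))$ be the largest integer $q$ with $(I(G)^q)_{\mathfrak c}\ne 0$, and let $\mathcal W(\mathfrak c,G)$ be the minimal set of monomial generators of $(I(G)^{\delta_{\mathfrak c}(I(G))})_{\mathfrak c}$. For positive integers $m,d$ and $\mathfrak a\in\mathbb Z_{>0}^m$ with $d\le a_1+\cdots+a_m$, let $\mathbf V_m^{(d)}(\mathfrak a)$ be the minimal set of monomial generators of $((y_1,\dots,y_m)^d)_{\mathfrak a}\subset K[y_1,\dots,y_m]$. The set $\mathcal W(\mathfrak c,G)$ is said to be of Veronese type if, for some such $m,d,\mathfrak a$, some monomial $w\in S$, and some choice of $m$ distinct variables of $S$ playing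 the roles of $y_1,\dots,y_m$, one has $\mathcal W(\mathfrak c,G)=w\cdot\mathbf V_m^{(d)}(\mathfrak a)$; and $G$ is said to be of Veronese type if $\mathcal W(\mathfrak c,G)$ is of Veronese type for every $\mathfrak c\in\mathbb Z_{>0}^n$. Let $n\ge 3$ and let $C_n$ be the cycle of length $n$, with vertices $x_1,\dots,x_n$ and edges $\{x_1,x_2\},\dots,\{x_{n-1},x_n\},\{x_n,x_1\}$. Then $C_n$ is of Veronese type if and only if $3\le n\le 7$. -/

import Mathlib

open MvPolynomial

/-- The ideal `I_c`, generated by those monomials belonging to `I` whose exponent vectors are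
componentwise bounded above by `c`. -/
noncomputable def boundedPart {σ K : Type*} [Field K] (c : σ → ℕ) (I : Ideal (MvPolynomial σ K)) :
    Ideal (MvPolynomial σ K) :=
  Ideal.span {f | ∃ a : σ →₀ ℕ, (∀ i, a i ≤ c i) ∧ f = monomial a 1 ∧ f ∈ I}

/-- The edge ideal `I(G)`, generated by the monomials `x_i x_j` with `{x_i, x_j}` an edge. -/
noncomputable def edgeIdeal (K : Type*) [Field K] {V : Type*} (G : SimpleGraph V) :
    Ideal (MvPolynomial V K) :=
  Ideal.span {f | ∃ i j, G.Adj i j ∧ f = X i * X j}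

/-- `δ_c(I)`: the largest integer `q` for which `(I ^ q)_c ≠ 0`.  See
`isGreatest_boundedExponent_edgeIdeal`: for edge ideals this is an actual maximum. -/
noncomputable def boundedExponent {σ K : Type*} [Field K] (c : σ → ℕ)
    (I : Ideal (MvPolynomial σ K)) : ℕ :=
  sSup {q | boundedPart c (I ^ q) ≠ ⊥}

/-- The minimal set of monomial generators of a monomial ideal `I`: the monomials of `I` that are
minimal with respect to divisibility.  See `isLeast_minimalMonomialGenerators`. -/
def minimalMonomialGenerators {σ K : Type*} [Field K] (I : Ideal (MvPolynomial σ K)) :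
    Set (MvPolynomial σ K) :=
  {f | ∃ a : σ →₀ ℕ, f = monomial a 1 ∧ f ∈ I ∧
    ∀ b : σ →₀ ℕ, b ≤ a → monomial b (1 : K) ∈ I → b = a}

/-- `W(c, G)`: the minimal set of monomial generators of `(I(G) ^ δ_c(I(G)))_c`. -/
noncomputable def boundedPowerGenerators (K : Type*) [Field K] {V : Type*} (G : SimpleGraph V)
    (c : V → ℕ) : Set (MvPolynomial V K) :=
  minimalMonomialGenerators
    (boundedPart c (edgeIdeal K G ^ boundedExponent c (edgeIdeal K G)))

/-- `V_m^{(d)}(a)`: the minimal set of monomial generators of `((x_1, ..., x_m) ^ d)_a`. -/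
def veroneseGenerators (K : Type*) [Field K] {m : ℕ} (d : ℕ) (a : Fin m → ℕ) :
    Set (MvPolynomial (Fin m) K) :=
  minimalMonomialGenerators (boundedPart a (idealOfVars (Fin m) K ^ d))

/-- A set `W` of monomials is of Veronese type if it is of the form `w · V_m^{(d)}(a)`, where
`m, d` and the entries of `a` are positive, `d ≤ a_1 + ... + a_m`, `w` is a monomial, and the
variables of `V_m^{(d)}(a)` are `m` distinct variables of the ambient ring (selected by `φ`). -/
def IsOfVeroneseType {σ K : Type*} [Field K] (W : Set (MvPolynomial σ K)) : Prop :=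
  ∃ (m d : ℕ) (a : Fin m → ℕ) (φ : Fin m ↪ σ) (w : σ →₀ ℕ),
    0 < m ∧ 0 < d ∧ (∀ i, 0 < a i) ∧ d ≤ ∑ i, a i ∧
      W = (fun v => monomial w 1 * rename φ v) '' veroneseGenerators K d a

/-- A graph `G` is of Veronese type (over `K`) if `W(c, G)` is of Veronese type for every vector
`c` of positive integers. -/
def SimpleGraph.IsOfVeroneseType (K : Type*) [Field K] {V : Type*} (G : SimpleGraph V) : Prop :=
  ∀ c : V → ℕ, (∀ i, 0 < c i) → _root_.IsOfVeroneseType (boundedPowerGenerators K G c)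

/-- If `I` is a monomial ideal, then `minimalMonomialGenerators I` generates `I` and is contained
in every set of monomials generating `I`. -/
theorem isLeast_minimalMonomialGenerators {σ K : Type*} [Field K] (A : Set (σ →₀ ℕ)) :
    IsLeast {T : Set (MvPolynomial σ K) | (∀ f ∈ T, ∃ a : σ →₀ ℕ, f = monomial a 1) ∧
        Ideal.span T = Ideal.span ((fun a => monomial a (1 : K)) '' A)}
      (minimalMonomialGenerators (Ideal.span ((fun a => monomial a (1 : K)) '' A))) := by
  classical
  refine ⟨⟨fun f hf => hf.imp fun a h => h.1, le_antisymm ?_ ?_⟩, ?_⟩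
  · rw [Ideal.span_le]
    rintro f ⟨a, -, hf, -⟩
    exact hf
  · set I : Ideal (MvPolynomial σ K) := Ideal.span ((fun a => monomial a (1 : K)) '' A) with hI
    rw [hI, Ideal.span_le, ← hI]
    have key : ∀ a : σ →₀ ℕ, monomial a (1 : K) ∈ I →
        monomial a (1 : K) ∈ Ideal.span (minimalMonomialGenerators I) := by
      intro a
      induction a using WellFoundedLT.induction with
      | ind a ih =>
        intro ha
        by_cases h : ∀ b : σ →₀ ℕ, b ≤ a → monomial b (1 : K) ∈ I → b = a
        · exact Ideal.subset_span ⟨a, rfl, ha, h⟩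
        · push Not at h
          obtain ⟨b, hba, hbI, hne⟩ := h
          have hb := ih b (lt_of_le_of_ne hba hne) hbI
          have : monomial a (1 : K) = monomial (a - b) 1 * monomial b 1 := by
            rw [monomial_mul, tsub_add_cancel_of_le hba, one_mul]
          rw [this]
          exact Ideal.mul_mem_left _ _ hb
    rintro _ ⟨a, ha, rfl⟩
    exact key a (Ideal.subset_span ⟨a, ha, rfl⟩)
  · rintro T ⟨hT, hspan⟩ f ⟨a, rfl, ha, hmin⟩
    have hT' : T = (fun a => monomial a (1 : K)) '' {a | monomial a (1 : K) ∈ T} := by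
      ext f
      constructor
      · intro hf
        obtain ⟨b, rfl⟩ := hT f hf
        exact ⟨b, hf, rfl⟩
      · rintro ⟨b, hb, rfl⟩
        exact hb
    have ha' := ha
    rw [← hspan, hT', mem_ideal_span_monomial_image] at ha'
    obtain ⟨b, hbT, hba⟩ := ha' a (by simp [mem_support_iff])
    have hb : b = a := hmin b hba (hspan ▸ Ideal.subset_span hbT)
    exact hb ▸ hbT

/-- `δ_c(I(G))` is the maximum of the set of those `q` with `(I(G) ^ q)_c ≠ 0`. -/
theorem isGreatest_boundedExponent_edgeIdeal {V K : Type*} [Fintype V] [Field K]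
    (G : SimpleGraph V) (c : V → ℕ) :
    IsGreatest {q | boundedPart c (edgeIdeal K G ^ q) ≠ ⊥}
      (boundedExponent c (edgeIdeal K G)) := by
  have hne : (0 : ℕ) ∈ {q | boundedPart c (edgeIdeal K G ^ q) ≠ ⊥} := by
    intro h
    have h1 : (monomial (0 : V →₀ ℕ) (1 : K)) ∈ boundedPart c (edgeIdeal K G ^ 0) :=
      Ideal.subset_span ⟨0, by simp, rfl, by simp⟩
    rw [h, Ideal.mem_bot] at h1
    simp at h1
  have hbdd : BddAbove {q | boundedPart c (edgeIdeal K G ^ q) ≠ ⊥} := by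
    refine ⟨∑ i, c i, fun q hq => ?_⟩
    by_contra hlt
    apply hq
    rw [boundedPart, Ideal.span_eq_bot]
    rintro f ⟨a, hac, rfl, hf⟩
    exfalso
    have hle : edgeIdeal K G ≤ idealOfVars V K := by
      rw [edgeIdeal, Ideal.span_le]
      rintro _ ⟨i, j, -, rfl⟩
      exact Ideal.mul_mem_left _ _ (Ideal.subset_span ⟨j, rfl⟩)
    have hmem := Ideal.pow_right_mono hle q hf
    rw [monomial_mem_pow_idealOfVars_iff _ _ one_ne_zero, Finsupp.degree_eq_sum] at hmem
    exact hlt (hmem.trans (Finset.sum_le_sum fun i _ => hac i))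
  exact ⟨Nat.sSup_mem ⟨0, hne⟩ hbdd, fun q hq => le_csSup hbdd hq⟩

/-! In exponent vectors, `W(c, C_n)` is the set `B` of degree vectors bounded by `c` of multisets of
`δ` edges, with `δ` as large as possible. Veronese type means that `B` is a slice, of fixed degree,
of a box. So it suffices that `B` contains every vector of the right degree between its
coordinatewise minima and maxima (`isOfVeroneseType_of_hull`), and it is necessary that `B` contains
those between any two of its members (`mem_of_between_of_isOfVeroneseType`).

For `n ≤ 7`, a vector of sum `2q` is a degree vector iff no independent set carries more than `q`
(`isCycleDegree_of_forall_indep_sum_le`). If `c` has sum at least `2δ + 2`, maximality of `δ` yields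
an independent set `S` carrying exactly `δ` in every member of `B`, all of which equal `c` off `S`
(`exists_tight_superset_deficient`). Now `S` has at most three vertices, so for any independent `T`
one of `T ∩ S`, `S \ T` has at most one vertex. A bound on a single coordinate then compares `t` on
`T` with a member of `B` (`isCycleDegree_of_between`).

For `n ≥ 8` there is room for `0, 2, 4, 6` in `S`. Two members of `B` differ by moving one unit from
2 to 0 and one from 4 to 6; moving one unit from 2 to 6 instead stays between them but leaves vertex
1 without a partner. -/

/-! ### Monomial ideals as sets of exponent vectors -/

/-- The exponent vectors that are sums of `q` elements of `A`. -/
def sumsOf {σ : Type*} (A : Set (σ →₀ ℕ)) : ℕ → Set (σ →₀ ℕ)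
  | 0 => {0}
  | q + 1 => {a | ∃ b ∈ sumsOf A q, ∃ e ∈ A, a = b + e}

/-- The exponent vectors of the generators of the edge ideal. -/
def edgeExponents {V : Type*} (G : SimpleGraph V) : Set (V →₀ ℕ) :=
  {a | ∃ i j, G.Adj i j ∧ a = Finsupp.single i 1 + Finsupp.single j 1}

theorem span_monomial_pow {σ K : Type*} [Field K] (A : Set (σ →₀ ℕ)) (q : ℕ) :
    Ideal.span ((fun a => monomial a (1 : K)) '' A) ^ q =
      Ideal.span ((fun a => monomial a (1 : K)) '' sumsOf A q) := by
  induction q with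
  | zero => simp [sumsOf, Ideal.one_eq_top]
  | succ q ih =>
    rw [pow_succ, ih, Ideal.span_mul_span']
    congr 1
    ext f
    simp only [Set.mem_mul, Set.mem_image, sumsOf, Set.mem_ofPred_eq]
    constructor
    · rintro ⟨_, ⟨b, hb, rfl⟩, _, ⟨e, he, rfl⟩, rfl⟩
      exact ⟨b + e, ⟨b, hb, e, he, rfl⟩, by simp [monomial_mul]⟩
    · rintro ⟨_, ⟨b, hb, e, he, rfl⟩, rfl⟩
      exact ⟨_, ⟨b, hb, rfl⟩, _, ⟨e, he, rfl⟩, by simp [monomial_mul]⟩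

theorem monomial_mem_span_monomial {σ K : Type*} [Field K] (A : Set (σ →₀ ℕ)) (a : σ →₀ ℕ) :
    monomial a (1 : K) ∈ Ideal.span ((fun a => monomial a (1 : K)) '' A) ↔ ∃ b ∈ A, b ≤ a := by
  classical
  rw [mem_ideal_span_monomial_image]
  simp [support_monomial]

theorem boundedPart_span_monomial {σ K : Type*} [Field K] (c : σ → ℕ) (A : Set (σ →₀ ℕ)) :
    boundedPart c (Ideal.span ((fun a => monomial a (1 : K)) '' A)) =
      Ideal.span ((fun a => monomial a (1 : K)) '' {a ∈ A | ∀ i, a i ≤ c i}) := by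
  apply le_antisymm
  · rw [boundedPart, Ideal.span_le]
    rintro _ ⟨a, hac, rfl, ha⟩
    obtain ⟨b, hb, hba⟩ := (monomial_mem_span_monomial A a).1 ha
    exact (monomial_mem_span_monomial _ a).2 ⟨b, ⟨hb, fun i => (hba i).trans (hac i)⟩, hba⟩
  · refine Ideal.span_mono ?_
    rintro _ ⟨a, ⟨ha, hac⟩, rfl⟩
    exact ⟨a, hac, rfl, Ideal.subset_span ⟨a, ha, rfl⟩⟩

theorem minimalMonomialGenerators_span_monomial {σ K : Type*} [Field K] (A : Set (σ →₀ ℕ))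
    (hA : IsAntichain (· ≤ ·) A) :
    minimalMonomialGenerators (Ideal.span ((fun a => monomial a (1 : K)) '' A)) =
      (fun a => monomial a (1 : K)) '' A := by
  ext f
  constructor
  · rintro ⟨a, rfl, ha, hmin⟩
    obtain ⟨b, hb, hba⟩ := (monomial_mem_span_monomial A a).1 ha
    have := hmin b hba ((monomial_mem_span_monomial A b).2 ⟨b, hb, le_rfl⟩)
    exact ⟨a, this ▸ hb, rfl⟩
  · rintro ⟨a, ha, rfl⟩
    refine ⟨a, rfl, Ideal.subset_span ⟨a, ha, rfl⟩, fun b hba hb => ?_⟩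
    obtain ⟨e, he, heb⟩ := (monomial_mem_span_monomial A b).1 hb
    have := hA.eq he ha (heb.trans hba)
    exact le_antisymm hba (this ▸ heb)

theorem edgeIdeal_eq_span_monomial (K : Type*) [Field K] {V : Type*} (G : SimpleGraph V) :
    edgeIdeal K G = Ideal.span ((fun a => monomial a (1 : K)) '' edgeExponents G) := by
  rw [edgeIdeal]
  congr 1
  ext f
  constructor
  · rintro ⟨i, j, h, rfl⟩
    exact ⟨_, ⟨i, j, h, rfl⟩, by simp [X, monomial_mul]⟩
  · rintro ⟨_, ⟨i, j, h, rfl⟩, rfl⟩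
    exact ⟨i, j, h, by simp [X, monomial_mul]⟩

theorem degree_of_mem_sumsOf {σ : Type*} {A : Set (σ →₀ ℕ)} {e : ℕ}
    (hA : ∀ a ∈ A, a.degree = e) {q : ℕ} {a : σ →₀ ℕ} (ha : a ∈ sumsOf A q) :
    a.degree = q * e := by
  induction q generalizing a with
  | zero =>
    obtain rfl : a = 0 := ha
    simp
  | succ q ih =>
    obtain ⟨b, hb, e', he, rfl⟩ := ha
    rw [map_add, ih hb, hA _ he]
    ring

/-- Equal degrees rule out proper divisibility, so every generator of the ideals in question is
minimal. -/
theorem isAntichain_of_degree {σ : Type*} {A : Set (σ →₀ ℕ)} {e : ℕ}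
    (hA : ∀ a ∈ A, a.degree = e) : IsAntichain (· ≤ ·) A := by
  intro a ha b hb hne hab
  apply hne
  obtain ⟨d, rfl⟩ := le_iff_exists_add.1 (show a ≤ b from hab)
  have h1 := hA _ ha
  have h2 := hA _ hb
  rw [map_add, h1] at h2
  have : d = 0 := (Finsupp.degree_eq_zero_iff d).1 (by omega)
  simp [this]

theorem boundedPart_edgeIdeal_pow (K : Type*) [Field K] {V : Type*} (G : SimpleGraph V)
    (c : V → ℕ) (q : ℕ) :
    boundedPart c (edgeIdeal K G ^ q) = Ideal.span ((fun a => monomial a (1 : K)) ''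
      {a ∈ sumsOf (edgeExponents G) q | ∀ i, a i ≤ c i}) := by
  rw [edgeIdeal_eq_span_monomial, span_monomial_pow, boundedPart_span_monomial]

theorem degree_of_mem_sumsOf_edgeExponents {V : Type*} {G : SimpleGraph V} {q : ℕ} {a : V →₀ ℕ}
    (ha : a ∈ sumsOf (edgeExponents G) q) : a.degree = q * 2 := by
  refine degree_of_mem_sumsOf ?_ ha
  rintro _ ⟨i, j, -, rfl⟩
  simp [map_add, Finsupp.degree_single]

theorem boundedPowerGenerators_eq (K : Type*) [Field K] {V : Type*} (G : SimpleGraph V)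
    (c : V → ℕ) :
    boundedPowerGenerators K G c = (fun a => monomial a (1 : K)) ''
      {a ∈ sumsOf (edgeExponents G) (boundedExponent c (edgeIdeal K G)) | ∀ i, a i ≤ c i} := by
  rw [boundedPowerGenerators, boundedPart_edgeIdeal_pow, minimalMonomialGenerators_span_monomial]
  exact isAntichain_of_degree fun a ha => degree_of_mem_sumsOf_edgeExponents ha.1

theorem isGreatest_boundedExponent_sumsOf (K : Type*) [Field K] {V : Type*} [Fintype V]
    (G : SimpleGraph V) (c : V → ℕ) :
    IsGreatest {q | ∃ a ∈ sumsOf (edgeExponents G) q, ∀ i, a i ≤ c i}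
      (boundedExponent c (edgeIdeal K G)) := by
  convert isGreatest_boundedExponent_edgeIdeal (K := K) G c using 1
  ext q
  rw [Set.mem_ofPred_eq, Set.mem_ofPred_eq, boundedPart_edgeIdeal_pow, ne_eq, Ideal.span_eq_bot]
  constructor
  · rintro ⟨a, ha⟩ h
    have := h _ ⟨a, ha, rfl⟩
    simp at this
  · intro h
    by_contra hne
    apply h
    rintro _ ⟨a, ha, rfl⟩
    exact (hne ⟨a, ha⟩).elim

theorem veroneseGenerators_eq (K : Type*) [Field K] {m : ℕ} (d : ℕ) (a : Fin m → ℕ) :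
    veroneseGenerators K d a = (fun v => monomial v (1 : K)) ''
      {v : Fin m →₀ ℕ | v.degree = d ∧ ∀ i, v i ≤ a i} := by
  have h : idealOfVars (Fin m) K ^ d =
      Ideal.span ((fun v => monomial v (1 : K)) '' {v : Fin m →₀ ℕ | v.degree = d}) := by
    exact pow_idealOfVars_eq_span d
  rw [veroneseGenerators, h, boundedPart_span_monomial, minimalMonomialGenerators_span_monomial]
  · rfl
  · exact isAntichain_of_degree fun a ha => ha.1

/-! ### Veronese type as a box condition on exponent vectors -/

theorem isOfVeroneseType_image_iff (K : Type*) [Field K] {σ : Type*} (B : Set (σ →₀ ℕ)) :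
    IsOfVeroneseType ((fun a => monomial a (1 : K)) '' B) ↔
      ∃ (m d : ℕ) (a : Fin m → ℕ) (φ : Fin m ↪ σ) (w : σ →₀ ℕ),
        0 < m ∧ 0 < d ∧ (∀ i, 0 < a i) ∧ d ≤ ∑ i, a i ∧
          B = (fun v => w + Finsupp.mapDomain φ v) ''
            {v : Fin m →₀ ℕ | v.degree = d ∧ ∀ i, v i ≤ a i} := by
  have hinj : Function.Injective (fun a : σ →₀ ℕ => monomial a (1 : K)) :=
    fun a b h => monomial_left_injective one_ne_zero h
  rw [IsOfVeroneseType]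
  refine exists_congr fun m => exists_congr fun d => exists_congr fun a => exists_congr fun φ =>
    exists_congr fun w => and_congr_right fun _ => and_congr_right fun _ => and_congr_right fun _ =>
    and_congr_right fun _ => ?_
  rw [veroneseGenerators_eq, ← hinj.image_injective.eq_iff, Set.image_image, Set.image_image]
  simp [rename_monomial, monomial_mul]

theorem mem_of_between_of_isOfVeroneseType (K : Type*) [Field K] {σ : Type*} [Fintype σ]
    {B : Set (σ →₀ ℕ)} (hB : IsOfVeroneseType ((fun a => monomial a (1 : K)) '' B))
    {p q t : σ →₀ ℕ} (hp : p ∈ B) (hq : q ∈ B) (ht : t.degree = p.degree)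
    (hl : ∀ i, min (p i) (q i) ≤ t i) (hu : ∀ i, t i ≤ max (p i) (q i)) : t ∈ B := by
  obtain ⟨m, d, a, φ, w, -, -, -, -, rfl⟩ := (isOfVeroneseType_image_iff K B).1 hB
  obtain ⟨v, ⟨hvd, hva⟩, rfl⟩ := hp
  obtain ⟨v', ⟨hvd', hva'⟩, rfl⟩ := hq
  have hw : w ≤ t := fun i => le_trans (by simp) (hl i)
  obtain ⟨s, rfl⟩ := le_iff_exists_add.1 hw
  -- Off the range of `φ` both `p` and `q` agree with `w`, which forces `s` to vanish there.
  have hs : Finsupp.mapDomain φ (Finsupp.comapDomain φ s φ.injective.injOn) = s := by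
    apply Finsupp.mapDomain_comapDomain _ φ.injective
    intro i hi
    by_contra hir
    have := hu i
    simp only [Finsupp.add_apply, Finsupp.mapDomain_of_notMem_range _ _ hir] at this
    simp at this hi
    omega
  refine ⟨Finsupp.comapDomain φ s φ.injective.injOn, ⟨?_, fun i => ?_⟩, by simp [hs]⟩
  · have h2 : (Finsupp.mapDomain φ v).degree = s.degree := by
      simpa [map_add] using ht.symm
    rw [Finsupp.degree_mapDomain] at h2
    rw [← Finsupp.degree_mapDomain φ, hs, ← h2, hvd]
  · have := hu (φ i)
    simp only [Finsupp.add_apply, Finsupp.mapDomain_apply φ.injective] at this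
    rw [Finsupp.comapDomain_apply]
    have h1 := hva i
    have h2 := hva' i
    omega

/-- The common factor is `w = l`, the variables are those with `l i < h i`, and their bounds are `h
i - l i`. Strictness in `hlN` supplies the required `0 < d`. -/
theorem isOfVeroneseType_of_box (K : Type*) [Field K] {σ : Type*} [Fintype σ]
    {B : Set (σ →₀ ℕ)} {l h : σ →₀ ℕ} {N : ℕ} (hlN : l.degree < N) (hNh : N ≤ h.degree)
    (hlh : l ≤ h) (hB : ∀ u, u ∈ B ↔ u.degree = N ∧ l ≤ u ∧ u ≤ h) :
    IsOfVeroneseType ((fun a => monomial a (1 : K)) '' B) := by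
  classical
  rw [isOfVeroneseType_image_iff]
  obtain ⟨s, rfl⟩ := le_iff_exists_add.1 hlh
  let e := s.support.equivFin
  let φ : Fin s.support.card ↪ σ := e.symm.toEmbedding.trans (Function.Embedding.subtype _)
  have hφ : ∀ i, φ i ∈ s.support := fun i => (e.symm i).2
  have hr : ∀ i ∈ s.support, i ∈ Set.range φ := fun i hi => ⟨e ⟨i, hi⟩, by simp [φ]⟩
  have hsum : ∑ i, s (φ i) = s.degree := by
    rw [Finsupp.degree_apply, ← Finset.sum_coe_sort s.support]
    exact e.symm.sum_comp fun i => s i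
  rw [map_add] at hNh
  refine ⟨s.support.card, N - l.degree, fun i => s (φ i), φ, l, ?_, by omega, ?_,
    by dsimp only; omega, ?_⟩
  · rw [Finset.card_pos, Finsupp.support_nonempty_iff]
    rintro rfl
    simp at hNh
    omega
  · intro i
    exact Nat.pos_of_ne_zero (Finsupp.mem_support_iff.1 (hφ i))
  · ext u
    rw [hB]
    constructor
    · rintro ⟨hd, hlu, huh⟩
      obtain ⟨v, rfl⟩ := le_iff_exists_add.1 hlu
      have hvs : v ≤ s := by simpa using huh
      have hv : Finsupp.mapDomain φ (Finsupp.comapDomain φ v φ.injective.injOn) = v := by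
        apply Finsupp.mapDomain_comapDomain _ φ.injective
        exact fun i hi => hr i (Finsupp.support_mono hvs hi)
      refine ⟨Finsupp.comapDomain φ v φ.injective.injOn, ⟨?_, fun i => ?_⟩, by simp [hv]⟩
      · rw [← Finsupp.degree_mapDomain φ, hv]
        rw [map_add] at hd
        omega
      · exact hvs (φ i)
    · rintro ⟨v, ⟨hvd, hvs⟩, rfl⟩
      refine ⟨?_, by simp, ?_⟩
      · simp only [map_add, Finsupp.degree_mapDomain, hvd]
        omega
      · simp only [add_le_add_iff_left]
        intro i
        by_cases hi : i ∈ Set.range φ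
        · obtain ⟨j, rfl⟩ := hi
          rw [Finsupp.mapDomain_apply φ.injective]
          exact hvs j
        · rw [Finsupp.mapDomain_of_notMem_range _ _ hi]
          exact Nat.zero_le _

theorem isOfVeroneseType_of_hull (K : Type*) [Field K] {σ : Type*} [Fintype σ]
    {B : Set (σ →₀ ℕ)} {N : ℕ} (hN : 0 < N) (hne : B.Nonempty) (hdeg : ∀ u ∈ B, u.degree = N)
    (hull : ∀ t : σ →₀ ℕ, t.degree = N → (∀ i, ∃ p ∈ B, p i ≤ t i) → (∀ i, ∃ p ∈ B, t i ≤ p i) →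
      t ∈ B) :
    IsOfVeroneseType ((fun a => monomial a (1 : K)) '' B) := by
  classical
  obtain ⟨p₀, hp₀⟩ := hne
  have hmin : ∀ i, ∃ p ∈ B, ∀ q ∈ B, p i ≤ q i := by
    intro i
    obtain ⟨p, hp, hpq⟩ := (measure fun p : σ →₀ ℕ => p i).wf.has_min B ⟨p₀, hp₀⟩
    exact ⟨p, hp, fun q hq => not_lt.1 (hpq q hq)⟩
  have hmax : ∀ i, ∃ p ∈ B, ∀ q ∈ B, q i ≤ p i := by
    intro i
    -- Coordinates are at most the degree `N`, so minimizing `N - p i` maximizes `p i`.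
    obtain ⟨p, hp, hpq⟩ := (measure fun p : σ →₀ ℕ => N - p i).wf.has_min B ⟨p₀, hp₀⟩
    refine ⟨p, hp, fun q hq => ?_⟩
    have h1 : ¬ (N - q i < N - p i) := hpq q hq
    have h2 := Finsupp.le_degree i q
    have h3 := Finsupp.le_degree i p
    rw [hdeg _ hq] at h2
    rw [hdeg _ hp] at h3
    omega
  choose L hL hL' using hmin
  choose H hH hH' using hmax
  let l : σ →₀ ℕ := Finsupp.equivFunOnFinite.symm fun i => L i i
  let h : σ →₀ ℕ := Finsupp.equivFunOnFinite.symm fun i => H i i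
  have hmem : ∀ u, u ∈ B ↔ u.degree = N ∧ l ≤ u ∧ u ≤ h := fun u =>
    ⟨fun hu => ⟨hdeg u hu, fun i => hL' i u hu, fun i => hH' i u hu⟩, fun ⟨h1, h2, h3⟩ =>
      hull u h1 (fun i => ⟨L i, hL i, h2 i⟩) (fun i => ⟨H i, hH i, h3 i⟩)⟩
  obtain ⟨h1, h2, h3⟩ := (hmem p₀).1 hp₀
  have h4 : l.degree ≤ N := h1 ▸ Finsupp.degree_mono h2
  have h5 : N ≤ h.degree := h1 ▸ Finsupp.degree_mono h3
  rcases h4.lt_or_eq with h4 | h4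
  · exact isOfVeroneseType_of_box K h4 h5 (h2.trans h3) hmem
  -- Here `B = {l}` and the box with lower corner `l` would give `d = 0`. Lowering one nonzero
  -- coordinate of the corner gives `d = 1` in one variable.
  · have heq : ∀ u : σ →₀ ℕ, u.degree = N → l ≤ u → u = l := by
      intro u hu hlu
      obtain ⟨s, rfl⟩ := le_iff_exists_add.1 hlu
      rw [map_add] at hu
      have : s = 0 := (Finsupp.degree_eq_zero_iff s).1 (by omega)
      simp [this]
    obtain ⟨i, hi⟩ : ∃ i, l i ≠ 0 := by
      by_contra! hl
      have : l = 0 := Finsupp.ext hl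
      rw [this] at h4
      simp at h4
      omega
    have hsplit : l = (l - Finsupp.single i 1) + Finsupp.single i 1 := by
      rw [tsub_add_cancel_of_le]
      rw [Finsupp.single_le_iff]
      omega
    refine isOfVeroneseType_of_box K (l := l - Finsupp.single i 1) (h := l) (N := N) ?_ h4.ge
      tsub_le_self fun u => ?_
    · have := congrArg Finsupp.degree hsplit
      rw [map_add, Finsupp.degree_single] at this
      omega
    · rw [hmem]
      constructor
      · rintro ⟨hu, hlu, -⟩
        exact ⟨hu, tsub_le_self.trans hlu, (heq u hu hlu).le⟩
      · rintro ⟨hu, -, hul⟩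
        have : u = l := by
          obtain ⟨s, hs⟩ := le_iff_exists_add.1 hul
          have h7 := congrArg Finsupp.degree hs
          rw [map_add] at h7
          have : s = 0 := (Finsupp.degree_eq_zero_iff s).1 (by omega)
          simp [hs, this]
        subst this
        exact ⟨hu, le_rfl, h2.trans h3⟩

/-! ### Degree vectors of edge multisets on a cycle -/

/-- The degree of the vertex `v` of the cycle, where the edge `{v, v + 1}` has multiplicity
`x v`. -/
def cycleDegree {k : ℕ} (x : Fin (k + 3) → ℕ) (v : Fin (k + 3)) : ℕ := x v + x (v - 1)

/-- `u` is the degree vector of `q` edges (with multiplicities) of the cycle. -/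
def IsCycleDegree {k : ℕ} (q : ℕ) (u : Fin (k + 3) → ℕ) : Prop :=
  ∃ x : Fin (k + 3) → ℕ, ∑ v, x v = q ∧ ∀ v, u v = cycleDegree x v

theorem mem_edgeExponents_cycleGraph {k : ℕ} {a : Fin (k + 3) →₀ ℕ} :
    a ∈ edgeExponents (SimpleGraph.cycleGraph (k + 3)) ↔
      ∃ v, a = Finsupp.single v 1 + Finsupp.single (v + 1) 1 := by
  constructor
  · rintro ⟨i, j, h, rfl⟩
    rw [SimpleGraph.cycleGraph_adj] at h
    rcases h with h | h
    · obtain rfl : i = j + 1 := sub_eq_iff_eq_add'.1 h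
      exact ⟨j, add_comm _ _⟩
    · obtain rfl : j = i + 1 := sub_eq_iff_eq_add'.1 h
      exact ⟨i, rfl⟩
  · rintro ⟨v, rfl⟩
    exact ⟨v, v + 1, SimpleGraph.cycleGraph_adj.2 (Or.inr (by simp)), rfl⟩

theorem single_add_single_apply {k : ℕ} (v w : Fin (k + 3)) :
    (Finsupp.single v 1 + Finsupp.single (v + 1) 1 : Fin (k + 3) →₀ ℕ) w =
      cycleDegree (Pi.single v 1) w := by
  classical
  rw [cycleDegree, Finsupp.add_apply, Finsupp.single_apply, Finsupp.single_apply, Pi.single_apply,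
    Pi.single_apply]
  congr 1
  · simp only [eq_comm]
  · simp only [sub_eq_iff_eq_add, eq_comm (a := v + 1)]

theorem mem_sumsOf_edgeExponents_cycleGraph {k q : ℕ} {a : Fin (k + 3) →₀ ℕ} :
    a ∈ sumsOf (edgeExponents (SimpleGraph.cycleGraph (k + 3))) q ↔ IsCycleDegree q a := by
  classical
  induction q generalizing a with
  | zero =>
    constructor
    · intro h
      obtain rfl : a = 0 := h
      exact ⟨0, by simp, fun v => by simp [cycleDegree]⟩
    · rintro ⟨x, hx, ha⟩
      have h0 : ∀ v, x v = 0 := by simpa using hx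
      show a = 0
      ext v
      simp [ha, cycleDegree, h0]
  | succ q ih =>
    constructor
    · rintro ⟨b, hb, e, he, rfl⟩
      obtain ⟨x, hx, hbx⟩ := ih.1 hb
      obtain ⟨v, rfl⟩ := mem_edgeExponents_cycleGraph.1 he
      refine ⟨x + Pi.single v 1, by simp [Finset.sum_add_distrib, hx], fun w => ?_⟩
      rw [Finsupp.add_apply, single_add_single_apply, hbx]
      simp only [cycleDegree, Pi.add_apply]
      ring
    · rintro ⟨x, hx, ha⟩
      obtain ⟨v, hv⟩ : ∃ v, x v ≠ 0 := by
        by_contra! h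
        simp [h] at hx
      have hxs : x - Pi.single v 1 + Pi.single v 1 = x := by
        ext w
        by_cases hw : w = v
        · subst hw
          simp only [Pi.add_apply, Pi.sub_apply, Pi.single_eq_same]
          omega
        · simp [Pi.single_eq_of_ne hw]
      refine ⟨Finsupp.equivFunOnFinite.symm (cycleDegree (x - Pi.single v 1)),
        ih.2 ⟨x - Pi.single v 1, ?_, fun w => rfl⟩, _, mem_edgeExponents_cycleGraph.2 ⟨v, rfl⟩, ?_⟩
      · have := hx
        rw [← hxs] at this
        simp only [Pi.add_apply, Finset.sum_add_distrib, Finset.sum_pi_single', Finset.mem_univ,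
          if_true] at this
        omega
      · ext w
        rw [Finsupp.add_apply, single_add_single_apply, ha]
        conv_lhs => rw [← hxs]
        simp only [cycleDegree, Pi.add_apply, Finsupp.equivFunOnFinite_symm_apply_apply]
        ring

/-! ### Independent sets and tightness -/

/-- Independent sets of vertices of the cycle. -/
def IsCycleIndep {k : ℕ} (S : Finset (Fin (k + 3))) : Prop := ∀ v ∈ S, v + 1 ∉ S

theorem sum_cycleDegree {k : ℕ} (x : Fin (k + 3) → ℕ) (S : Finset (Fin (k + 3))) :
    ∑ v ∈ S, cycleDegree x v =
      ∑ v, x v * ((if v ∈ S then 1 else 0) + (if v + 1 ∈ S then 1 else 0)) := by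
  have h : ∑ v, (if v + 1 ∈ S then x v else 0) = ∑ v, (if v ∈ S then x (v - 1) else 0) := by
    rw [← Equiv.sum_comp (Equiv.addRight (1 : Fin (k + 3)))
      fun v => if v ∈ S then x (v - 1) else 0]
    simp
  simp only [cycleDegree, mul_add, mul_ite, mul_one, mul_zero, Finset.sum_add_distrib, h]
  simp [Finset.sum_ite_mem]

theorem sum_univ_cycleDegree {k : ℕ} (x : Fin (k + 3) → ℕ) :
    ∑ v, cycleDegree x v = 2 * ∑ v, x v := by
  rw [sum_cycleDegree, Finset.mul_sum]
  simp [mul_comm]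

theorem IsCycleIndep.sum_cycleDegree_le {k : ℕ} {S : Finset (Fin (k + 3))} (hS : IsCycleIndep S)
    (x : Fin (k + 3) → ℕ) : ∑ v ∈ S, cycleDegree x v ≤ ∑ v, x v := by
  rw [sum_cycleDegree]
  refine Finset.sum_le_sum fun v _ => ?_
  have := hS v
  by_cases h1 : v ∈ S <;> by_cases h2 : v + 1 ∈ S <;> simp_all

/-- An edge meets an independent set at most once, so equality says that every edge in use meets
`S`; such an `S` is called tight below. -/
theorem IsCycleIndep.sum_cycleDegree_eq_iff {k : ℕ} {S : Finset (Fin (k + 3))}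
    (hS : IsCycleIndep S) (x : Fin (k + 3) → ℕ) :
    ∑ v ∈ S, cycleDegree x v = ∑ v, x v ↔ ∀ v, x v = 0 ∨ (v ∈ S ∨ v + 1 ∈ S) := by
  rw [sum_cycleDegree, Finset.sum_eq_sum_iff_of_le]
  · simp only [Finset.mem_univ, true_imp_iff]
    refine forall_congr' fun v => ?_
    have := hS v
    by_cases h1 : v ∈ S <;> by_cases h2 : v + 1 ∈ S <;> simp_all [eq_comm]
  · intro v _
    have := hS v
    by_cases h1 : v ∈ S <;> by_cases h2 : v + 1 ∈ S <;> simp_all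

theorem IsCycleIndep.two_mul_card_le {k : ℕ} {S : Finset (Fin (k + 3))} (hS : IsCycleIndep S) :
    2 * S.card ≤ k + 3 := by
  -- With every edge used once, all degrees are 2.
  have h := hS.sum_cycleDegree_le fun _ => 1
  simp [cycleDegree] at h
  omega

/-- The majority of three finite sets. -/
def majority {α : Type*} [DecidableEq α] (A B C : Finset α) : Finset α :=
  (A ∩ B) ∪ (A ∩ C) ∪ (B ∩ C)

theorem mem_majority {α : Type*} [DecidableEq α] {A B C : Finset α} {v : α} :
    v ∈ majority A B C ↔ v ∈ A ∧ v ∈ B ∨ v ∈ A ∧ v ∈ C ∨ v ∈ B ∧ v ∈ C := by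
  simp only [majority, Finset.mem_union, Finset.mem_inter]
  tauto

theorem IsCycleIndep.majority {k : ℕ} {A B C : Finset (Fin (k + 3))} (hA : IsCycleIndep A)
    (hB : IsCycleIndep B) (hC : IsCycleIndep C) : IsCycleIndep (majority A B C) := by
  intro v
  have := hA v
  have := hB v
  have := hC v
  simp only [mem_majority]
  tauto

/-- A Helly property: independence and tightness are conjunctions of conditions on two vertices
each, hence preserved by majority. Deleting `a`, `b`, `c` in turn from `P` gives three sets by
induction, and each vertex of `P` lies in at least two of them. -/
theorem exists_tight_superset {k : ℕ} (x : Fin (k + 3) → ℕ) (P : Finset (Fin (k + 3)))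
    (hP : ∀ i ∈ P, ∀ j ∈ P, ∃ S, IsCycleIndep S ∧ (∀ v, x v = 0 ∨ (v ∈ S ∨ v + 1 ∈ S)) ∧
      i ∈ S ∧ j ∈ S) (hne : P.Nonempty) :
    ∃ S, IsCycleIndep S ∧ (∀ v, x v = 0 ∨ (v ∈ S ∨ v + 1 ∈ S)) ∧ P ⊆ S := by
  classical
  induction hm : P.card using Nat.strong_induction_on generalizing P with
  | _ m ih =>
    subst hm
    obtain ⟨a, ha⟩ := hne
    by_cases h1 : ∃ b ∈ P, b ≠ a
    · obtain ⟨b, hb, hba⟩ := h1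
      by_cases h2 : ∃ c ∈ P, c ≠ a ∧ c ≠ b
      · obtain ⟨c, hc, hca, hcb⟩ := h2
        have key : ∀ d ∈ P, ∀ e ∈ P, e ≠ d → ∃ S, IsCycleIndep S ∧
            (∀ v, x v = 0 ∨ (v ∈ S ∨ v + 1 ∈ S)) ∧ P.erase d ⊆ S := by
          intro d hd e he hed
          exact ih _ (Finset.card_erase_lt_of_mem hd) (P.erase d)
            (fun i hi j hj => hP i (Finset.mem_of_mem_erase hi) j (Finset.mem_of_mem_erase hj))
            ⟨e, Finset.mem_erase.2 ⟨hed, he⟩⟩ rfl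
        obtain ⟨A, hA, tA, sA⟩ := key a ha b hb hba
        obtain ⟨B, hB, tB, sB⟩ := key b hb a ha hba.symm
        obtain ⟨C, hC, tC, sC⟩ := key c hc a ha hca.symm
        refine ⟨majority A B C, hA.majority hB hC, fun v => ?_, fun v hv => ?_⟩
        · have := tA v
          have := tB v
          have := tC v
          simp only [mem_majority]
          tauto
        · have h1 : v ≠ a → v ∈ A := fun h => sA (Finset.mem_erase.2 ⟨h, hv⟩)
          have h2 : v ≠ b → v ∈ B := fun h => sB (Finset.mem_erase.2 ⟨h, hv⟩)
          have h3 : v ≠ c → v ∈ C := fun h => sC (Finset.mem_erase.2 ⟨h, hv⟩)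
          rw [mem_majority]
          grind
      · obtain ⟨S, hS, tS, haS, hbS⟩ := hP a ha b hb
        refine ⟨S, hS, tS, fun v hv => ?_⟩
        grind
    · obtain ⟨S, hS, tS, haS, -⟩ := hP a ha a ha
      refine ⟨S, hS, tS, fun v hv => ?_⟩
      grind

/-! ### Cycles of length at most 7 -/

set_option maxHeartbeats 1000000 in
theorem isCycleDegree_of_forall_indep_sum_le {k : ℕ} (hk : k ≤ 4) {q : ℕ}
    {u : Fin (k + 3) → ℕ} (hu : ∑ v, u v = 2 * q)
    (h : ∀ S, IsCycleIndep S → ∑ v ∈ S, u v ≤ q) : IsCycleDegree q u := by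
  unfold IsCycleIndep at h
  unfold IsCycleDegree cycleDegree
  interval_cases k
  · have h0 := h {0} (by decide)
    have h1 := h {1} (by decide)
    have h2 := h {2} (by decide)
    simp [Fin.sum_univ_succ] at hu h0 h1 h2
    -- On an odd cycle the multiplicities are forced: alternate vertices starting at `v + 2` meet
    -- every edge but `{v, v + 1}` exactly once, so `x v` is `q` minus their total.
    refine ⟨![q - u 2, q - u 0, q - u 1], ?_, ?_⟩
    · simp [Fin.sum_univ_succ]
      omega
    · intro v
      fin_cases v <;> simp <;> omega
  · have h0 := h {0, 2} (by decide)
    have h1 := h {1, 3} (by decide)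
    simp [Fin.sum_univ_succ] at hu h0 h1
    -- On an even cycle `x 0` is a free parameter; its least admissible value is taken, truncated
    -- subtraction supplying the bound `0 ≤ x 0`.
    refine ⟨![u 1 - u 2, u 1 - (u 1 - u 2), u 2 - u 1, u 0 - (u 1 - u 2)], ?_, ?_⟩
    · simp [Fin.sum_univ_succ]
      omega
    · intro v
      fin_cases v <;> simp <;> omega
  · have h0 := h {0, 2} (by decide)
    have h1 := h {1, 3} (by decide)
    have h2 := h {2, 4} (by decide)
    have h3 := h {3, 0} (by decide)
    have h4 := h {4, 1} (by decide)
    simp [Fin.sum_univ_succ] at hu h0 h1 h2 h3 h4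
    refine ⟨![q - u 2 - u 4, q - u 3 - u 0, q - u 4 - u 1, q - u 0 - u 2, q - u 1 - u 3], ?_, ?_⟩
    · simp [Fin.sum_univ_succ]
      omega
    · intro v
      fin_cases v <;> simp <;> omega
  · have h0 := h {0, 2, 4} (by decide)
    have h1 := h {1, 3, 5} (by decide)
    have h2 := h {0, 3} (by decide)
    have h3 := h {1, 4} (by decide)
    have h4 := h {2, 5} (by decide)
    simp [Fin.sum_univ_succ] at hu h0 h1 h2 h3 h4
    -- The least `x 0` for which `x 0`, `x 2` and `x 4` are all nonnegative.
    obtain ⟨t, ht⟩ : ∃ t, t = max (u 1 - u 2) (u 1 + u 3 - u 2 - u 4) := ⟨_, rfl⟩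
    refine ⟨![t, u 1 - t, u 2 + t - u 1, u 3 + u 1 - u 2 - t, u 4 + u 2 + t - u 1 - u 3, u 0 - t], ?_, ?_⟩
    · simp [Fin.sum_univ_succ]
      omega
    · intro v
      fin_cases v <;> simp <;> omega
  · have h0 := h {0, 2, 4} (by decide)
    have h1 := h {1, 3, 5} (by decide)
    have h2 := h {2, 4, 6} (by decide)
    have h3 := h {3, 5, 0} (by decide)
    have h4 := h {4, 6, 1} (by decide)
    have h5 := h {5, 0, 2} (by decide)
    have h6 := h {6, 1, 3} (by decide)
    simp [Fin.sum_univ_succ] at hu h0 h1 h2 h3 h4 h5 h6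
    refine ⟨![q - u 2 - u 4 - u 6, q - u 3 - u 5 - u 0, q - u 4 - u 6 - u 1, q - u 5 - u 0 - u 2, q - u 6 - u 1 - u 3, q - u 0 - u 2 - u 4, q - u 1 - u 3 - u 5], ?_, ?_⟩
    · simp [Fin.sum_univ_succ]
      omega
    · intro v
      fin_cases v <;> simp <;> omega

theorem IsCycleDegree.sum_eq {k q : ℕ} {u : Fin (k + 3) → ℕ} (h : IsCycleDegree q u) :
    ∑ v, u v = 2 * q := by
  obtain ⟨x, rfl, hx⟩ := h
  simp only [hx, sum_univ_cycleDegree]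

theorem IsCycleDegree.sum_indep_le {k q : ℕ} {u : Fin (k + 3) → ℕ} (h : IsCycleDegree q u)
    {S : Finset (Fin (k + 3))} (hS : IsCycleIndep S) : ∑ v ∈ S, u v ≤ q := by
  obtain ⟨x, rfl, hx⟩ := h
  simp only [hx]
  exact hS.sum_cycleDegree_le x

/-- Adding one unit at each of two deficient places (possibly the same vertex) cannot give a degree
vector, so some independent set violates the criterion; it must be tight and contain both. The Helly
property yields one tight set containing all deficient vertices. -/
theorem exists_tight_superset_deficient {k q : ℕ} (hk : k ≤ 4) {c : Fin (k + 3) → ℕ}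
    (hmax : ∀ u, IsCycleDegree (q + 1) u → ¬ u ≤ c) (hc : 2 * q + 2 ≤ ∑ v, c v)
    {u : Fin (k + 3) → ℕ} (hu : IsCycleDegree q u) (huc : u ≤ c) :
    ∃ S, IsCycleIndep S ∧ ∑ v ∈ S, u v = q ∧ ∀ v, v ∉ S → u v = c v := by
  classical
  have hsum := hu.sum_eq
  obtain ⟨x, rfl, hx⟩ := id hu
  have hadd : ∀ i j (S : Finset (Fin (k + 3))), ∑ v ∈ S,
      (u + Pi.single i 1 + Pi.single j 1 : Fin (k + 3) → ℕ) v =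
        ∑ v ∈ S, u v + (if i ∈ S then 1 else 0) + (if j ∈ S then 1 else 0) := by
    intro i j S
    simp [Finset.sum_add_distrib]
  have pair : ∀ i j, u + Pi.single i 1 + Pi.single j 1 ≤ c →
      ∃ S, IsCycleIndep S ∧ (∀ v, x v = 0 ∨ (v ∈ S ∨ v + 1 ∈ S)) ∧ i ∈ S ∧ j ∈ S := by
    intro i j hij
    by_contra! hne
    refine hmax _ (isCycleDegree_of_forall_indep_sum_le hk ?_ fun S hS => ?_) hij
    · rw [hadd, hsum]
      simp
      ring
    · rw [hadd]
      have h1 := hu.sum_indep_le hS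
      by_contra! h2
      have h3 : i ∈ S := by
        by_contra h
        rw [if_neg h] at h2
        split_ifs at h2 <;> omega
      have h4 : j ∈ S := by
        by_contra h
        rw [if_neg h] at h2
        split_ifs at h2
        omega
      rw [if_pos h3, if_pos h4] at h2
      refine hne S hS ((hS.sum_cycleDegree_eq_iff x).1 ?_) h3 h4
      simp only [hx] at h1 h2
      omega
  have hdef : ∀ i j, u i < c i → u j < c j → i ≠ j → u + Pi.single i 1 + Pi.single j 1 ≤ c := by
    intro i j hi hj hij v
    have := huc v
    simp only [Pi.add_apply, Pi.single_apply]
    split_ifs with h1 h2 h2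
    · exact absurd (h1.symm.trans h2) hij
    · subst h1
      omega
    · subst h2
      omega
    · simpa
  -- If `i` is the only deficient vertex, the total slack of at least 2 sits there, and `j = i`
  -- works.
  have hself : ∀ i, u i < c i → ∃ j, u + Pi.single i 1 + Pi.single j 1 ≤ c := by
    intro i hi
    by_contra! hne
    have h1 : ∀ v, v ≠ i → c v = u v := fun v hv => by
      by_contra h
      exact hne v (hdef i v hi (lt_of_le_of_ne (huc v) (Ne.symm h)) hv.symm)
    have h2 : c i ≤ u i + 1 := by
      by_contra! h
      refine hne i fun v => ?_
      have := huc v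
      simp only [Pi.add_apply, Pi.single_apply]
      split_ifs with h3
      · subst h3
        omega
      · simpa
    rw [← Finset.add_sum_erase _ c (Finset.mem_univ i)] at hc
    rw [← Finset.add_sum_erase _ u (Finset.mem_univ i)] at hsum
    rw [show ∑ v ∈ Finset.univ.erase i, c v = ∑ v ∈ Finset.univ.erase i, u v from
      Finset.sum_congr rfl fun v hv => h1 v (Finset.ne_of_mem_erase hv)] at hc
    omega
  obtain ⟨i₀, hi₀⟩ : ∃ i, u i < c i := by
    by_contra! h
    have := Finset.sum_le_sum fun v (_ : v ∈ Finset.univ) => h v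
    omega
  obtain ⟨S, hS, tS, hPS⟩ := exists_tight_superset x (Finset.univ.filter fun v => u v < c v)
    (by
      intro i hi j hj
      simp only [Finset.mem_filter, Finset.mem_univ, true_and] at hi hj
      by_cases hij : i = j
      · subst hij
        obtain ⟨j, hj'⟩ := hself i hi
        obtain ⟨S, hS, tS, hiS, -⟩ := pair i j hj'
        exact ⟨S, hS, tS, hiS, hiS⟩
      · exact pair i j (hdef i j hi hj hij)) ⟨i₀, by simpa using hi₀⟩
  refine ⟨S, hS, ?_, fun v hv => ?_⟩
  · simp only [hx]
    exact (hS.sum_cycleDegree_eq_iff x).2 tS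
  · by_contra h
    exact hv (hPS (by simpa using lt_of_le_of_ne (huc v) h))

theorem isCycleDegree_of_between {k q : ℕ} (hk : k ≤ 4) {c : Fin (k + 3) → ℕ}
    (hmax : ∀ u, IsCycleDegree (q + 1) u → ¬ u ≤ c) {u t : Fin (k + 3) → ℕ}
    (hu : IsCycleDegree q u) (huc : u ≤ c) (ht : ∑ v, t v = 2 * q) (htc : t ≤ c)
    (hl : ∀ i, ∃ p, IsCycleDegree q p ∧ p ≤ c ∧ p i ≤ t i)
    (hh : ∀ i, ∃ p, IsCycleDegree q p ∧ p ≤ c ∧ t i ≤ p i) : IsCycleDegree q t := by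
  classical
  rcases le_or_gt (∑ v, c v) (2 * q + 1) with hc | hc
  · by_cases htc' : t = c
    · suffices u = t from this ▸ hu
      subst htc'
      ext v
      exact (Finset.sum_eq_sum_iff_of_le fun v _ => huc v).1 (hu.sum_eq.trans ht.symm) v
        (Finset.mem_univ v)
    · obtain ⟨i, hi⟩ : ∃ i, t i < c i := by
        by_contra! h
        exact htc' (le_antisymm htc h)
      obtain ⟨p, hp, hpc, hpi⟩ := hl i
      suffices p = t from this ▸ hp
      -- The sum of `c` exceeds that of `t` by at most one, and `i` accounts for it.
      have htv : ∀ v, v ≠ i → t v = c v := by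
        intro v hv
        by_contra hne
        have h1 : t v < c v := lt_of_le_of_ne (htc v) hne
        have hv' : v ∈ Finset.univ.erase i := Finset.mem_erase.2 ⟨hv, Finset.mem_univ v⟩
        rw [← Finset.add_sum_erase _ _ (Finset.mem_univ i), ← Finset.add_sum_erase _ _ hv']
          at hc ht
        have h2 := Finset.sum_le_sum fun w (_ : w ∈ (Finset.univ.erase i).erase v) => htc w
        omega
      have hpt : ∀ v, p v ≤ t v := by
        intro v
        by_cases hv : v = i
        · exact hv ▸ hpi
        · exact htv v hv ▸ hpc v
      ext v
      exact (Finset.sum_eq_sum_iff_of_le fun v _ => hpt v).1 (hp.sum_eq.trans ht.symm) v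
        (Finset.mem_univ v)
  · obtain ⟨S, hS, huS, hSc⟩ := exists_tight_superset_deficient hk hmax hc hu huc
    have hcS : ∑ v ∈ Sᶜ, c v = q := by
      have h1 := Finset.sum_add_sum_compl S u
      rw [huS, hu.sum_eq, show ∑ v ∈ Sᶜ, u v = ∑ v ∈ Sᶜ, c v from
        Finset.sum_congr rfl fun v hv => hSc v (Finset.mem_compl.1 hv)] at h1
      omega
    -- Both `p(S) ≤ q` and `p(Sᶜ) ≤ c(Sᶜ) = q` must be equalities, as `p` has sum `2q`.
    have hmem : ∀ p, IsCycleDegree q p → p ≤ c → ∑ v ∈ S, p v = q ∧ ∀ v, v ∉ S → p v = c v := by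
      intro p hp hpc
      have h1 := Finset.sum_add_sum_compl S p
      have h2 := hp.sum_indep_le hS
      have h3 := Finset.sum_le_sum fun v (_ : v ∈ Sᶜ) => hpc v
      rw [hp.sum_eq] at h1
      refine ⟨by omega, fun v hv => ?_⟩
      exact (Finset.sum_eq_sum_iff_of_le fun v _ => hpc v).1 (by omega) v
        (Finset.mem_compl.2 hv)
    have htc : ∀ v, v ∉ S → t v = c v := by
      intro v hv
      obtain ⟨p, hp, hpc, hpv⟩ := hl v
      exact le_antisymm (htc v) ((hmem p hp hpc).2 v hv ▸ hpv)
    have htS : ∑ v ∈ S, t v = q := by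
      have h1 := Finset.sum_add_sum_compl S t
      rw [ht, show ∑ v ∈ Sᶜ, t v = ∑ v ∈ Sᶜ, c v from
        Finset.sum_congr rfl fun v hv => htc v (Finset.mem_compl.1 hv)] at h1
      omega
    have hcard : S.card ≤ 3 := by
      have := hS.two_mul_card_le
      omega
    refine isCycleDegree_of_forall_indep_sum_le hk ht fun T hT => ?_
    have hcmp : ∀ p, IsCycleDegree q p → p ≤ c →
        ∑ v ∈ T ∩ S, t v ≤ ∑ v ∈ T ∩ S, p v → ∑ v ∈ T, t v ≤ q := by
      intro p hp hpc hle
      refine le_trans ?_ (hp.sum_indep_le hT)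
      rw [← Finset.sum_inter_add_sum_sdiff T S t, ← Finset.sum_inter_add_sum_sdiff T S p]
      refine add_le_add hle (Finset.sum_le_sum fun v hv => ?_)
      have hv := (Finset.mem_sdiff.1 hv).2
      rw [htc v hv, (hmem p hp hpc).2 v hv]
    have hle : ∀ Q : Finset (Fin (k + 3)), Q.card ≤ 1 →
        (∃ p, IsCycleDegree q p ∧ p ≤ c ∧ ∑ v ∈ Q, t v ≤ ∑ v ∈ Q, p v) ∧
        ∃ p, IsCycleDegree q p ∧ p ≤ c ∧ ∑ v ∈ Q, p v ≤ ∑ v ∈ Q, t v := by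
      intro Q hQ
      rcases Q.eq_empty_or_nonempty with rfl | hne
      · exact ⟨⟨u, hu, huc, by simp⟩, ⟨u, hu, huc, by simp⟩⟩
      · obtain ⟨e, rfl⟩ := Finset.card_eq_one.1 (le_antisymm hQ hne.card_pos)
        simpa using ⟨hh e, hl e⟩
    have hsplit := Finset.card_inter_add_card_sdiff S T
    rcases le_or_gt (T ∩ S).card 1 with h1 | h1
    · obtain ⟨p, hp, hpc, hpt⟩ := (hle _ h1).1
      exact hcmp p hp hpc hpt
    · rw [Finset.inter_comm] at h1
      -- Both `t` and `p` carry `q` on `S`, so a lower bound for `t` on `S \ T` is an upper bound on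
      -- `T ∩ S`.
      obtain ⟨p, hp, hpc, hpt⟩ := (hle (S \ T) (by omega)).2
      refine hcmp p hp hpc ?_
      have h2 := Finset.sum_inter_add_sum_sdiff S T t
      have h3 := Finset.sum_inter_add_sum_sdiff S T p
      rw [htS] at h2
      rw [(hmem p hp hpc).1] at h3
      rw [Finset.inter_comm]
      omega

theorem isOfVeroneseType_cycleGraph_of_le (K : Type*) [Field K] {k : ℕ} (hk : k ≤ 4) :
    (SimpleGraph.cycleGraph (k + 3)).IsOfVeroneseType K := by
  intro c hc
  have hgr := isGreatest_boundedExponent_sumsOf K (SimpleGraph.cycleGraph (k + 3)) c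
  rw [boundedPowerGenerators_eq]
  obtain ⟨⟨a, ha, hac⟩, hub⟩ := hgr
  -- A single edge fits below `c`, so the degree `2 * q` is positive.
  have hpos := hub (show 1 ∈ _ from ⟨Finsupp.single 0 1 + Finsupp.single (0 + 1) 1,
    ⟨0, rfl, _, mem_edgeExponents_cycleGraph.2 ⟨0, rfl⟩, by simp⟩, fun i => by
      have h1 := hc i
      have h2 : ¬ (0 = i ∧ 0 + 1 = i) := by
        rintro ⟨rfl, h⟩
        simp at h
      simp only [Finsupp.add_apply, Finsupp.single_apply]
      split_ifs <;> omega⟩)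
  set q := boundedExponent c (edgeIdeal K (SimpleGraph.cycleGraph (k + 3))) with hq
  simp only [mem_sumsOf_edgeExponents_cycleGraph] at ha hub ⊢
  refine isOfVeroneseType_of_hull K (N := 2 * q) (by omega) ⟨a, ha, hac⟩ ?_ ?_
  · rintro u ⟨hu, -⟩
    rw [Finsupp.degree_eq_sum, hu.sum_eq]
  · intro t ht hl hh
    rw [Finsupp.degree_eq_sum] at ht
    have htc : ∀ i, t i ≤ c i := fun i => by
      obtain ⟨p, hp, hpt⟩ := hh i
      exact hpt.trans (hp.2 i)
    refine ⟨isCycleDegree_of_between (c := c) hk (fun u hu huc => ?_) ha hac ht htc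
      (fun i => ?_) fun i => ?_, htc⟩
    · have := hub ⟨Finsupp.equivFunOnFinite.symm u, hu, huc⟩
      omega
    · obtain ⟨p, hp, hpt⟩ := hl i
      exact ⟨p, hp.1, hp.2, hpt⟩
    · obtain ⟨p, hp, hpt⟩ := hh i
      exact ⟨p, hp.1, hp.2, hpt⟩

/-! ### Cycles of length at least 8 -/

theorem val_add_one_eq {m : ℕ} (v : Fin (m + 1)) :
    (v + 1).val = if v.val = m then 0 else v.val + 1 := by
  rw [Fin.val_add_one]
  simp [Fin.ext_iff]

theorem val_sub_one_eq {m : ℕ} (v : Fin (m + 1)) :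
    (v - 1).val = if v.val = 0 then m else v.val - 1 := by
  rw [Fin.coe_sub_one]
  simp only [Fin.ext_iff, Fin.val_zero]

theorem not_isOfVeroneseType_cycleGraph (K : Type*) [Field K] (k : ℕ) :
    ¬ (SimpleGraph.cycleGraph (k + 5 + 3)).IsOfVeroneseType K := by
  classical
  intro hV
  let S : Finset (Fin (k + 5 + 3)) :=
    Finset.univ.filter fun v => v.val % 2 = 0 ∧ v.val ≠ k + 7
  let c : Fin (k + 5 + 3) → ℕ := fun v => if v ∈ S then 2 else 1
  -- Every edge used by `x` or `y` meets `S`, and every vertex off `S` has degree exactly 1. From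
  -- `x` to `y`, `{1, 2}` becomes `{0, 1}` and `{4, 5}` becomes `{5, 6}`.
  let x : Fin (k + 5 + 3) → ℕ := fun v =>
    if v.val = 1 ∨ v.val = 3 ∨ (v.val % 2 = 0 ∧ 4 ≤ v.val) then 1 else 0
  let y : Fin (k + 5 + 3) → ℕ := fun v =>
    if v.val = 0 ∨ v.val = 3 ∨ v.val = 5 ∨ (v.val % 2 = 0 ∧ 6 ≤ v.val) then 1 else 0
  have memS : ∀ v, v ∈ S ↔ v.val % 2 = 0 ∧ v.val ≠ k + 7 := fun v => by simp [S]
  have hS : IsCycleIndep S := by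
    intro v
    rw [memS, memS, val_add_one_eq]
    split_ifs <;> omega
  have tightx : ∀ v, x v = 0 ∨ (v ∈ S ∨ v + 1 ∈ S) := by
    intro v
    have := v.isLt
    rw [memS, memS, val_add_one_eq]
    simp only [x]
    split_ifs <;> omega
  have tighty : ∀ v, y v = 0 ∨ (v ∈ S ∨ v + 1 ∈ S) := by
    intro v
    have := v.isLt
    rw [memS, memS, val_add_one_eq]
    simp only [y]
    split_ifs <;> omega
  have hxS : ∀ v, v ∉ S → cycleDegree x v = 1 := by
    intro v
    have := v.isLt
    rw [memS]
    simp only [x, cycleDegree, val_sub_one_eq]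
    intro
    split_ifs <;> omega
  have hyS : ∀ v, v ∉ S → cycleDegree y v = 1 := by
    intro v
    have := v.isLt
    rw [memS]
    simp only [y, cycleDegree, val_sub_one_eq]
    intro
    split_ifs <;> omega
  have hle : ∀ z : Fin (k + 5 + 3) → ℕ, (∀ v, z v ≤ 1) → (∀ v, v ∉ S → cycleDegree z v = 1) →
      ∀ v, cycleDegree z v ≤ c v := by
    intro z hz hzS v
    by_cases hv : v ∈ S
    · simp only [c, if_pos hv, cycleDegree]
      have := hz v
      have := hz (v - 1)
      omega
    · simp only [c, if_neg hv, hzS v hv, le_refl]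
  have hxc := hle x (fun v => by simp only [x]; split_ifs <;> omega) hxS
  have hyc := hle y (fun v => by simp only [y]; split_ifs <;> omega) hyS
  have hsum : ∀ z : Fin (k + 5 + 3) → ℕ, (∀ v, z v = 0 ∨ (v ∈ S ∨ v + 1 ∈ S)) →
      (∀ v, v ∉ S → cycleDegree z v = 1) → ∑ v, z v = Sᶜ.card := by
    intro z hz hzS
    have h1 := Finset.sum_add_sum_compl S (cycleDegree z)
    rw [(hS.sum_cycleDegree_eq_iff z).2 hz, sum_univ_cycleDegree,
      show ∑ v ∈ Sᶜ, cycleDegree z v = ∑ v ∈ Sᶜ, 1 from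
        Finset.sum_congr rfl fun v hv => hzS v (Finset.mem_compl.1 hv)] at h1
    rw [Finset.card_eq_sum_ones]
    omega
  have hx := hsum x tightx hxS
  have hy := hsum y tighty hyS
  have hV := hV c fun v => by
    simp only [c]
    split_ifs <;> omega
  have hgr := isGreatest_boundedExponent_sumsOf K (SimpleGraph.cycleGraph (k + 5 + 3)) c
  have hdelta : boundedExponent c (edgeIdeal K (SimpleGraph.cycleGraph (k + 5 + 3))) = Sᶜ.card := by
    refine hgr.unique ⟨⟨Finsupp.equivFunOnFinite.symm (cycleDegree x),
      mem_sumsOf_edgeExponents_cycleGraph.2 ⟨x, hx, fun v => rfl⟩, hxc⟩, ?_⟩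
    -- Upper bound on `δ`: `2q = a(S) + a(Sᶜ) ≤ q + |Sᶜ|`.
    rintro q ⟨a, ha, hac⟩
    rw [mem_sumsOf_edgeExponents_cycleGraph] at ha
    have h1 := Finset.sum_add_sum_compl S a
    have h2 := ha.sum_indep_le hS
    have h3 : ∑ v ∈ Sᶜ, a v ≤ ∑ v ∈ Sᶜ, 1 := Finset.sum_le_sum fun v hv => by
      have := hac v
      rwa [show c v = 1 from if_neg (Finset.mem_compl.1 hv)] at this
    rw [ha.sum_eq] at h1
    rw [Finset.card_eq_sum_ones]
    omega
  rw [boundedPowerGenerators_eq, hdelta] at hV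
  have v0 : (0 : Fin (k + 5 + 3)).val = 0 := rfl
  have v1 : (1 : Fin (k + 5 + 3)).val = 1 := rfl
  have v2 : (2 : Fin (k + 5 + 3)).val = 2 := rfl
  have v6 : (6 : Fin (k + 5 + 3)).val = 6 := Nat.mod_eq_of_lt (show 6 < k + 5 + 3 by omega)
  let l : Fin (k + 5 + 3) := Fin.last (k + 7)
  have vl : l.val = k + 7 := rfl
  have vl' : (l - 1).val = k + 6 := by rw [val_sub_one_eq, vl]; simp
  -- The test vector is `x`'s degree vector with its one unit at 2 moved to 6.
  let s : Fin (k + 5 + 3) →₀ ℕ := Finsupp.equivFunOnFinite.symm fun v =>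
    if v = 2 then 0 else cycleDegree x v
  have hs : ∀ v, (s + Finsupp.single 6 1 : Fin (k + 5 + 3) →₀ ℕ) v =
      if v.val = 2 then 0 else cycleDegree x v + if v.val = 6 then 1 else 0 := by
    intro v
    rw [Finsupp.add_apply, Finsupp.single_apply]
    simp only [s, Finsupp.equivFunOnFinite_symm_apply_apply, Fin.ext_iff, v6, v2]
    split_ifs <;> omega
  have hx2 : cycleDegree x 2 = 1 := by
    simp only [cycleDegree, x, val_sub_one_eq, v2]
    simp
  have hmem := mem_of_between_of_isOfVeroneseType K hV
    (p := Finsupp.equivFunOnFinite.symm (cycleDegree x))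
    (q := Finsupp.equivFunOnFinite.symm (cycleDegree y)) (t := s + Finsupp.single 6 1)
    ⟨mem_sumsOf_edgeExponents_cycleGraph.2 ⟨x, hx, fun v => rfl⟩, hxc⟩
    ⟨mem_sumsOf_edgeExponents_cycleGraph.2 ⟨y, hy, fun v => rfl⟩, hyc⟩ ?_ ?_ ?_
  · obtain ⟨⟨z, hz, hzs⟩, -⟩ := And.imp_left mem_sumsOf_edgeExponents_cycleGraph.1 hmem
    have hzS : ∑ v ∈ Sᶜ, cycleDegree z v = Sᶜ.card := by
      rw [Finset.card_eq_sum_ones]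
      refine Finset.sum_congr rfl fun v hv => ?_
      have hv := Finset.mem_compl.1 hv
      rw [← hzs, hs, hxS v hv]
      rw [memS] at hv
      split_ifs <;> omega
    have tightz := (hS.sum_cycleDegree_eq_iff z).1 (by
      have h1 := Finset.sum_add_sum_compl S (cycleDegree z)
      rw [sum_univ_cycleDegree] at h1
      omega)
    have e0 := hzs 0
    have e1 := hzs 1
    have e2 := hzs 2
    have el := hzs l
    -- For even `n`, vertices 0 and 2 have degree 0, so vertex 1 has no usable edge. For odd `n`,
    -- tightness excludes the edge `{l - 1, l}`, so `l` uses up the single unit at 0 and vertex 1 is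
    -- again stuck.
    have t1 := tightz (l - 1)
    rw [sub_add_cancel, memS, memS, vl, vl'] at t1
    have m1 : (2 : Fin (k + 5 + 3)) - 1 = 1 := by
      rw [Fin.ext_iff, val_sub_one_eq, v2, v1]
      simp
    have m0 : (0 : Fin (k + 5 + 3)) - 1 = l := by
      rw [Fin.ext_iff, val_sub_one_eq, v0, vl]
      simp
    rw [hs] at e0 e1 e2 el
    simp only [cycleDegree, m1, m0, sub_self, x, v0, v1, v2, vl, vl'] at e0 e1 e2 el
    simp at e0 e1 e2
    split_ifs at e0 el <;> omega
  · have h2 : Finsupp.equivFunOnFinite.symm (cycleDegree x) = s + Finsupp.single 2 1 := by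
      ext v
      simp only [s, Finsupp.add_apply, Finsupp.single_apply,
        Finsupp.equivFunOnFinite_symm_apply_apply]
      by_cases hv : v = 2
      · subst hv
        simp [hx2]
      · simp [hv, Ne.symm hv]
    rw [h2, map_add, map_add, Finsupp.degree_single, Finsupp.degree_single]
  · intro v
    have := v.isLt
    rw [hs]
    simp only [Finsupp.equivFunOnFinite_symm_apply_apply, cycleDegree, x, y, val_sub_one_eq]
    split_ifs <;> omega
  · intro v
    have := v.isLt
    rw [hs]
    simp only [Finsupp.equivFunOnFinite_symm_apply_apply, cycleDegree, x, y, val_sub_one_eq]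
    split_ifs <;> omega

theorem mainTheorem11 (K : Type*) [Field K] (n : ℕ) (hn : 3 ≤ n) :
    (SimpleGraph.cycleGraph n).IsOfVeroneseType K ↔ 3 ≤ n ∧ n ≤ 7 := by
  obtain ⟨k, rfl⟩ := Nat.exists_eq_add_of_le' hn
  constructor
  · intro h
    refine ⟨hn, ?_⟩
    by_contra! h7
    obtain ⟨m, rfl⟩ := Nat.exists_eq_add_of_le' (show 5 ≤ k by omega)
    exact not_isOfVeroneseType_cycleGraph K m h
  · rintro ⟨-, h7⟩
    exact isOfVeroneseType_cycleGraph_of_le K (by omega)
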